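/- Consider unlabeled rooted plane trees, that is, a root together with a finite (possibly empty) ordered sequence of rooted plane trees; the size of a tree is its number of vertices. A leaf is a vertex without children, and the rank of a vertex is the length of the shortest downward path from it to a leaf (so leaves have rank $0$). For $n\ge 1$ let $E_T(n)$ denote the expected rank of a uniformly random vertex in a uniformly random rooted plane tree of size $n$. Then the series $\sum_{k=1}^{\infty}\frac{3}{4^k+2}$ converges and $$\lim_{n\to\infty} E_T(n)=\sum_{k=1}^{\infty}\frac{3}{4^k+2}\approx 0.727649,$$ where the numerical value is correct to six decimal places, i.e. with an error less than $5\cdot 10^{-7}$. -/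

import Mathlib

open scoped BigOperators Topology

/-- Unlabeled rooted plane (ordered) trees: a root with a finite, possibly empty, sequence of
subtrees. -/
inductive PlaneTree : Type
  | node (children : List PlaneTree) : PlaneTree

namespace PlaneTree

/-- The vertices of a plane tree. A vertex is identified with its address: the root is `[]`, and
`i :: v` is the vertex `v` of the `i`-th subtree of the root (counting from `0`). Thus the children
of the vertex `v` are the vertices of the form `v ++ [i]`. -/
def vertices : PlaneTree → Finset (List ℕ)
  | node l =>
    insert [] (Finset.univ.biUnion fun i : Fin l.length =>
      (vertices l[i]).image fun v => (i : ℕ) :: v)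
decreasing_by
  have := List.sizeOf_lt_of_mem (List.getElem_mem (l := l) i.isLt)
  simp only [node.sizeOf_spec, Fin.getElem_fin]
  omega

/-- The size of a tree is its number of vertices. -/
def size (t : PlaneTree) : ℕ := t.vertices.card

/-- A leaf is a vertex without children. -/
def IsLeaf (t : PlaneTree) (v : List ℕ) : Prop :=
  v ∈ t.vertices ∧ ∀ i : ℕ, v ++ [i] ∉ t.vertices

/-- The rank of a vertex `v`: the length of the shortest downward path from `v` to a leaf. A
downward path from `v` to a leaf `v ++ w` has `w.length` steps. -/
noncomputable def rank (t : PlaneTree) (v : List ℕ) : ℕ :=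
  sInf {d : ℕ | ∃ w : List ℕ, t.IsLeaf (v ++ w) ∧ w.length = d}

theorem size_node (l : List PlaneTree) :
    (node l).size = 1 + ∑ i : Fin l.length, (l[i]).size := by
  unfold size
  rw [vertices, Finset.card_insert_of_notMem (by simp), Finset.card_biUnion, add_comm]
  · congr 1
    refine Finset.sum_congr rfl fun i _ => ?_
    exact Finset.card_image_of_injective _ (List.cons_injective)
  · intro i _ j _ hij
    rw [Function.onFun, Finset.disjoint_left]
    intro a ha hb
    simp only [Finset.mem_image] at ha hb
    obtain ⟨v, _, rfl⟩ := ha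
    obtain ⟨w, _, h⟩ := hb
    exact hij (Fin.ext (List.cons.inj h).1.symm)

theorem size_pos (t : PlaneTree) : 0 < t.size := by
  cases t with
  | node l => rw [size_node]; omega

theorem finite_size_le (n : ℕ) : {t : PlaneTree | t.size ≤ n}.Finite := by
  induction n with
  | zero =>
    refine Set.Finite.subset Set.finite_empty fun t ht => ?_
    have := t.size_pos
    simp only [Set.mem_ofPred_eq] at ht
    omega
  | succ n ih =>
    have := ih.to_subtype
    refine (((List.finite_length_le {t : PlaneTree | t.size ≤ n} n).image
      (List.map Subtype.val)).image node).subset ?_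
    rintro ⟨l⟩ ht
    simp only [Set.mem_ofPred_eq, size_node] at ht
    have hl : l.length ≤ n := by
      have : ∑ _i : Fin l.length, 1 ≤ ∑ i : Fin l.length, (l[i]).size :=
        Finset.sum_le_sum fun i _ => size_pos _
      simp only [Finset.sum_const, Finset.card_univ, Fintype.card_fin, smul_eq_mul, mul_one] at this
      omega
    have hs : ∀ s ∈ l, s.size ≤ n := by
      intro s hs
      obtain ⟨i, hi, rfl⟩ := List.mem_iff_getElem.1 hs
      have := Finset.single_le_sum (f := fun i : Fin l.length => (l[i]).size)
        (fun _ _ => Nat.zero_le _) (Finset.mem_univ ⟨i, hi⟩)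
      simp only [Fin.getElem_fin] at this ht
      omega
    refine ⟨l, ⟨l.attach.map fun s => ⟨s.1, hs s.1 s.2⟩, ?_, ?_⟩, rfl⟩
    · change List.length _ ≤ n
      rwa [List.length_map, List.length_attach]
    · simp

/-- The finite set of all plane trees of size `n`. -/
noncomputable def ofSize (n : ℕ) : Finset PlaneTree :=
  ((finite_size_le n).subset fun _ ht => le_of_eq ht : {t : PlaneTree | t.size = n}.Finite).toFinset

/-- The expected rank of a random vertex in a random plane tree of size `n`: the tree is uniform
among the trees of size `n`, and the vertex is uniform among its vertices. -/
noncomputable def expectedRank (n : ℕ) : ℝ :=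
  𝔼 t ∈ ofSize n, 𝔼 v ∈ t.vertices, (t.rank v : ℝ)

end PlaneTree

/-! The rank of a vertex depends only on its fringe subtree, the tree of its descendants, so the
proof finds the limit law of that subtree. Splitting off the first child (`cons`) gives `T = X + T²`
for the tree series `T`, and `2 * total = R * (1 + T')` for the total rank, where `R` is the series
of root ranks (`genFun_totalRank`). Hence, given its size `j`, the fringe subtree is uniform, and as
`n` grows its size has limit law `2 c_j / 4^j`, with `c_j` the number of trees of size `j`. This law
has total mass one and the mean root rank at each size is at most 4, so Scheffé's lemma passes to
the limit (`tendsto_expectedRank`).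

The limit is twice the sum of `rank(t) * 4^(-|t|)` over all trees, that is `2 * ∑ W_{k+1}`, with
`W_k` the weight of the trees of root rank at least `k`. Such trees are sequences of trees, whence
`W_{k+1} = W_k / (4 (1 - W_k))`, `W_0 = 1/2`, which solves to `W_k = 3 / (2 * 4^k + 4)`
(`rankWeight_eq`). -/

namespace PlaneTree

/-! ### Leaves, ranks and the decomposition into first child and rest -/

theorem mem_vertices_node {l : List PlaneTree} {v : List ℕ} :
    v ∈ (node l).vertices ↔
      v = [] ∨ ∃ (i : ℕ) (h : i < l.length), ∃ w ∈ l[i].vertices, v = i :: w := by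
  rw [vertices]
  simp only [Finset.mem_insert, Finset.mem_biUnion, Finset.mem_univ, true_and, Finset.mem_image,
    Fin.getElem_fin]
  refine or_congr_right ⟨?_, ?_⟩
  · rintro ⟨i, w, hw, rfl⟩
    exact ⟨i, i.isLt, w, hw, rfl⟩
  · rintro ⟨i, h, w, hw, rfl⟩
    exact ⟨⟨i, h⟩, w, hw, rfl⟩

theorem nil_mem_vertices (t : PlaneTree) : [] ∈ t.vertices := by
  cases t
  exact mem_vertices_node.2 (Or.inl rfl)

theorem cons_mem_vertices_node {l : List PlaneTree} {i : ℕ} {w : List ℕ} :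
    i :: w ∈ (node l).vertices ↔ ∃ h : i < l.length, w ∈ l[i].vertices := by
  rw [mem_vertices_node]
  constructor
  · rintro (h | ⟨j, h, w', hw, e⟩)
    · cases h
    · obtain ⟨rfl, rfl⟩ := List.cons.inj e
      exact ⟨h, hw⟩
  · rintro ⟨h, hw⟩
    exact Or.inr ⟨i, h, w, hw, rfl⟩

theorem isLeaf_node_nil {l : List PlaneTree} : (node l).IsLeaf [] ↔ l = [] := by
  constructor
  · rintro ⟨-, h⟩
    by_contra hl
    exact h 0 (cons_mem_vertices_node.2 ⟨List.length_pos_iff.2 hl, nil_mem_vertices _⟩)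
  · rintro rfl
    refine ⟨nil_mem_vertices _, fun i hi => ?_⟩
    obtain ⟨h, -⟩ := cons_mem_vertices_node.1 hi
    simp at h

theorem isLeaf_node_cons {l : List PlaneTree} {i : ℕ} {w : List ℕ} :
    (node l).IsLeaf (i :: w) ↔ ∃ h : i < l.length, l[i].IsLeaf w := by
  unfold IsLeaf
  simp only [List.cons_append, cons_mem_vertices_node]
  constructor
  · rintro ⟨⟨h, hw⟩, h2⟩
    exact ⟨h, hw, fun j hj => h2 j ⟨h, hj⟩⟩
  · rintro ⟨h, hw, h2⟩
    exact ⟨⟨h, hw⟩, fun j ⟨_, hj⟩ => h2 j hj⟩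

theorem rank_node_cons {l : List PlaneTree} {i : ℕ} (h : i < l.length) (w : List ℕ) :
    (node l).rank (i :: w) = l[i].rank w := by
  unfold rank
  simp only [List.cons_append, isLeaf_node_cons, h, exists_true_left]

/-- The rank of the root. -/
noncomputable def rootRank (t : PlaneTree) : ℕ := t.rank []

/-- The tree obtained by attaching `a` as a new first child to the root of the second tree. -/
def cons (a : PlaneTree) : PlaneTree → PlaneTree
  | node l => node (a :: l)

theorem sum_children_cons (f : PlaneTree → ℕ) (a : PlaneTree) (l : List PlaneTree) :
    ∑ i : Fin (a :: l).length, f (a :: l)[i] = f a + ∑ i : Fin l.length, f l[i] :=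
  Fin.sum_univ_succ fun i : Fin (l.length + 1) => f (a :: l)[i]

/-- Structural induction along the decomposition of a tree into its first child and the rest. -/
theorem cons_induction {P : PlaneTree → Prop} (leaf : P (node []))
    (cons : ∀ a b, P a → P b → P (cons a b)) (t : PlaneTree) : P t := by
  induction h : t.size using Nat.strong_induction_on generalizing t with
  | _ n ih =>
    obtain ⟨_ | ⟨a, l⟩⟩ := t
    · exact leaf
    · have hs := size_node (a :: l)
      have hl := size_node l
      have ha := a.size_pos
      have hl' := (node l).size_pos
      rw [sum_children_cons] at hs
      exact cons a (node l) (ih _ (by omega) a rfl) (ih _ (by omega) (node l) rfl)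

theorem size_leaf : (node []).size = 1 := by simp [size_node]

theorem size_cons (a b : PlaneTree) : (cons a b).size = a.size + b.size := by
  obtain ⟨l⟩ := b
  rw [cons, size_node, size_node, sum_children_cons]
  omega

theorem exists_isLeaf (t : PlaneTree) : ∃ w, t.IsLeaf w := by
  induction t using cons_induction with
  | leaf => exact ⟨[], isLeaf_node_nil.2 rfl⟩
  | cons a b ha _ =>
    obtain ⟨w, hw⟩ := ha
    obtain ⟨l⟩ := b
    exact ⟨0 :: w, isLeaf_node_cons.2 ⟨by simp, by simpa using hw⟩⟩

theorem le_rootRank {t : PlaneTree} {k : ℕ} :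
    k ≤ t.rootRank ↔ ∀ w, t.IsLeaf w → k ≤ w.length := by
  unfold rootRank rank
  -- A leaf exists, so `sInf` is a true minimum and not its default value 0.
  obtain ⟨w, hw⟩ := t.exists_isLeaf
  have hne : {d : ℕ | ∃ w : List ℕ, t.IsLeaf ([] ++ w) ∧ w.length = d}.Nonempty :=
    ⟨w.length, w, hw, rfl⟩
  rw [le_csInf_iff (OrderBot.bddBelow _) hne]
  simp

theorem rootRank_leaf : (node []).rootRank = 0 := by
  by_contra h
  have := le_rootRank.1 (Nat.one_le_iff_ne_zero.2 h) [] (isLeaf_node_nil.2 rfl)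
  simp at this

/-- A path from a non-leaf root to a leaf starts with a step to a child. For `l = []` the right side
is vacuous while the rank is 0. -/
theorem succ_le_rootRank_node {l : List PlaneTree} {k : ℕ} (hl : l ≠ []) :
    k + 1 ≤ (node l).rootRank ↔ ∀ a ∈ l, k ≤ a.rootRank := by
  simp only [le_rootRank]
  constructor
  · intro h a ha w hw
    obtain ⟨i, hi, rfl⟩ := List.mem_iff_getElem.1 ha
    simpa using h (i :: w) (isLeaf_node_cons.2 ⟨hi, hw⟩)
  · rintro h (_ | ⟨i, w⟩) hw
    · exact absurd (isLeaf_node_nil.1 hw) hl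
    · obtain ⟨hi, hw⟩ := isLeaf_node_cons.1 hw
      simpa using h _ (List.getElem_mem hi) w hw

/-- Every child of the root has rank at least `k`. -/
def ChildrenRankGE (k : ℕ) : PlaneTree → Prop
  | node l => ∀ a ∈ l, k ≤ a.rootRank

theorem childrenRankGE_leaf (k : ℕ) : ChildrenRankGE k (node []) := by
  simp [ChildrenRankGE]

/-- Unlike a bound on the root rank, this condition splits as a product under `cons`, even when `b`
is a leaf. -/
theorem childrenRankGE_cons {k : ℕ} {a b : PlaneTree} :
    ChildrenRankGE k (cons a b) ↔ k ≤ a.rootRank ∧ ChildrenRankGE k b := by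
  obtain ⟨l⟩ := b
  simp [ChildrenRankGE, cons]

theorem succ_le_rootRank_cons {k : ℕ} {a b : PlaneTree} :
    k + 1 ≤ (cons a b).rootRank ↔ k ≤ a.rootRank ∧ ChildrenRankGE k b := by
  rw [← childrenRankGE_cons]
  obtain ⟨l⟩ := b
  exact succ_le_rootRank_node (List.cons_ne_nil _ _)

theorem rootRank_cons_le (a b : PlaneTree) : (cons a b).rootRank ≤ a.rootRank + 1 := by
  rcases h : (cons a b).rootRank with _ | k
  · omega
  · have := (succ_le_rootRank_cons.1 h.ge).1
    omega

/-! ### Additivity of the total rank -/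

/-- The sum of the ranks of all vertices. -/
noncomputable def totalRank (t : PlaneTree) : ℕ := ∑ v ∈ t.vertices, t.rank v

theorem totalRank_node (l : List PlaneTree) :
    (node l).totalRank = (node l).rootRank + ∑ i : Fin l.length, (l[i]).totalRank := by
  unfold totalRank
  rw [vertices, Finset.sum_insert (by simp), Finset.sum_biUnion]
  · congr 1
    refine Finset.sum_congr rfl fun i _ => ?_
    rw [Finset.sum_image List.cons_injective.injOn]
    exact Finset.sum_congr rfl fun w _ => rank_node_cons i.isLt w
  · intro i _ j _ hij
    rw [Function.onFun, Finset.disjoint_left]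
    intro a ha hb
    simp only [Finset.mem_image] at ha hb
    obtain ⟨v, _, rfl⟩ := ha
    obtain ⟨w, _, h⟩ := hb
    exact hij (Fin.ext (List.cons.inj h).1.symm)

/-- The sum of the ranks of all vertices other than the root. -/
noncomputable def properRank (t : PlaneTree) : ℕ := t.totalRank - t.rootRank

theorem totalRank_eq (t : PlaneTree) : t.totalRank = t.rootRank + t.properRank := by
  obtain ⟨l⟩ := t
  rw [properRank, totalRank_node]
  omega

theorem properRank_leaf : (node []).properRank = 0 := by
  simp [properRank, totalRank_node]

/-- The root of `a` becomes a proper vertex, while the root of `b` stays the root and is not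
counted. -/
theorem properRank_cons (a b : PlaneTree) :
    (cons a b).properRank = a.rootRank + a.properRank + b.properRank := by
  obtain ⟨l⟩ := b
  rw [← totalRank_eq, cons, properRank, properRank, totalRank_node, totalRank_node,
    sum_children_cons]
  omega

theorem mem_ofSize {n : ℕ} {t : PlaneTree} : t ∈ ofSize n ↔ t.size = n := by
  simp [ofSize]

theorem cons_injective2 : Function.Injective2 cons := by
  rintro a a' ⟨l⟩ ⟨l'⟩ h
  simpa [cons] using h

theorem cons_ne_leaf (a b : PlaneTree) : cons a b ≠ node [] := by
  obtain ⟨l⟩ := b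
  simp [cons]

theorem eq_leaf_or_cons (t : PlaneTree) : t = node [] ∨ ∃ a b, t = cons a b := by
  obtain ⟨_ | ⟨a, l⟩⟩ := t
  · exact Or.inl rfl
  · exact Or.inr ⟨a, node l, rfl⟩

/-- A tree is a single vertex or decomposes uniquely into its first child and the rest. -/
noncomputable def sumEquiv : Unit ⊕ PlaneTree × PlaneTree ≃ PlaneTree :=
  Equiv.ofBijective (Sum.elim (fun _ => node []) fun p => cons p.1 p.2) <| by
    constructor
    · rintro (⟨⟩ | ⟨a, b⟩) (⟨⟩ | ⟨a', b'⟩) h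
      · rfl
      · exact absurd h.symm (cons_ne_leaf _ _)
      · exact absurd h (cons_ne_leaf _ _)
      · obtain ⟨rfl, rfl⟩ := cons_injective2 h
        rfl
    · intro t
      obtain rfl | ⟨a, b, rfl⟩ := t.eq_leaf_or_cons
      · exact ⟨Sum.inl (), rfl⟩
      · exact ⟨Sum.inr (a, b), rfl⟩

theorem ofSize_eq (n : ℕ) [DecidableEq PlaneTree] :
    ofSize n = (if n = 1 then {node []} else ∅) ∪
      ((Finset.HasAntidiagonal.antidiagonal n).biUnion fun p =>
        (ofSize p.1 ×ˢ ofSize p.2).image fun q => cons q.1 q.2) := by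
  ext t
  simp only [mem_ofSize, Finset.mem_union, Finset.mem_biUnion, Finset.HasAntidiagonal.mem_antidiagonal,
    Finset.mem_image, Finset.mem_product]
  constructor
  · rintro rfl
    obtain rfl | ⟨a, b, rfl⟩ := t.eq_leaf_or_cons
    · left; simp [size_leaf]
    · right; exact ⟨(a.size, b.size), (size_cons a b).symm, (a, b), ⟨rfl, rfl⟩, rfl⟩
  · rintro (h | ⟨p, hp, q, ⟨h1, h2⟩, rfl⟩)
    · split_ifs at h with hn
      · rw [Finset.mem_singleton.1 h, size_leaf, hn]
      · simp at h
    · rw [size_cons, h1, h2, hp]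

theorem sum_ofSize (φ : PlaneTree → ℝ) (n : ℕ) :
    ∑ t ∈ ofSize n, φ t = (if n = 1 then φ (node []) else 0) +
      ∑ p ∈ Finset.HasAntidiagonal.antidiagonal n, ∑ a ∈ ofSize p.1, ∑ b ∈ ofSize p.2, φ (cons a b) := by
  classical
  rw [ofSize_eq, Finset.sum_union, Finset.sum_biUnion]
  · congr 1
    · split_ifs <;> simp
    · refine Finset.sum_congr rfl fun p _ => ?_
      rw [Finset.sum_image, Finset.sum_product]
      rintro ⟨a, b⟩ _ ⟨a', b'⟩ _ h
      obtain ⟨rfl, rfl⟩ := cons_injective2 h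
      rfl
  · intro p _ q _ hpq
    rw [Function.onFun, Finset.disjoint_left]
    simp only [Finset.mem_image, Finset.mem_product, mem_ofSize, not_exists, not_and]
    rintro _ ⟨x, ⟨h1, h2⟩, rfl⟩ y ⟨h3, h4⟩ e
    obtain ⟨e1, e2⟩ := cons_injective2 e
    exact hpq (Prod.ext (by rw [← h1, ← h3, e1]) (by rw [← h2, ← h4, e2]))
  · rw [Finset.disjoint_left]
    intro t ht
    simp only [Finset.mem_biUnion, Finset.mem_image, not_exists, not_and]
    rintro p - q - rfl
    split_ifs at ht
    · exact cons_ne_leaf _ _ (Finset.mem_singleton.1 ht)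
    · simp at ht

/-! ### Generating functions -/

open PowerSeries

/-- The generating function of a statistic on plane trees, by size. -/
noncomputable def genFun (φ : PlaneTree → ℝ) : PowerSeries ℝ :=
  PowerSeries.mk fun n => ∑ t ∈ ofSize n, φ t

theorem coeff_genFun (φ : PlaneTree → ℝ) (n : ℕ) :
    coeff n (genFun φ) = ∑ t ∈ ofSize n, φ t := coeff_mk _ _

theorem genFun_add (φ ψ : PlaneTree → ℝ) :
    genFun (fun t => φ t + ψ t) = genFun φ + genFun ψ := by
  ext n
  simp [coeff_genFun, Finset.sum_add_distrib]

theorem genFun_mul (φ ψ : PlaneTree → ℝ) :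
    genFun φ * genFun ψ = PowerSeries.mk fun n =>
      ∑ p ∈ Finset.HasAntidiagonal.antidiagonal n, ∑ a ∈ ofSize p.1, ∑ b ∈ ofSize p.2, φ a * ψ b := by
  ext n
  simp [coeff_mul, coeff_genFun, Finset.sum_mul_sum]

/-- The generating function of plane trees by size. -/
noncomputable def treeSeries : PowerSeries ℝ := genFun fun _ => 1

theorem treeSeries_eq : treeSeries = X + treeSeries * treeSeries := by
  rw [treeSeries, genFun_mul]
  ext n
  rw [coeff_genFun, sum_ofSize, map_add, coeff_X, coeff_mk]
  simp

/-- The generating function of a statistic counting the edges on the path of first children. -/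
theorem genFun_firstPath (d : PlaneTree → ℝ) (h0 : d (node []) = 0)
    (h : ∀ a b, d (cons a b) = d a + 1) :
    X * genFun d = treeSeries - X - X * treeSeries := by
  have key : genFun d = (genFun d + treeSeries) * treeSeries := by
    rw [treeSeries, ← genFun_add, genFun_mul]
    ext n
    rw [coeff_genFun, sum_ofSize, coeff_mk]
    simp [h0, h]
  -- With `D = genFun d`: `key` says `D(1 - T) = T²`, and `X = T(1 - T)`, so `X D = T³ = T - X - X
  -- T`.
  linear_combination (-(genFun d + 1 + treeSeries)) * treeSeries_eq + treeSeries * key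

theorem genFun_properRank :
    genFun (fun t => (t.properRank : ℝ)) =
      (genFun fun t => (t.rootRank : ℝ)) * treeSeries +
        2 * (genFun fun t => (t.properRank : ℝ)) * treeSeries := by
  have : genFun (fun t => (t.properRank : ℝ)) =
      (genFun fun t => (t.rootRank : ℝ) + t.properRank) * treeSeries +
        treeSeries * (genFun fun t => (t.properRank : ℝ)) := by
    rw [treeSeries, genFun_mul, genFun_mul]
    ext n
    rw [coeff_genFun, sum_ofSize, map_add, coeff_mk, coeff_mk]
    simp [properRank_leaf, properRank_cons, Finset.sum_add_distrib]
  rw [genFun_add] at this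
  linear_combination this

theorem derivative_treeSeries : d⁄dX ℝ treeSeries * (1 - 2 * treeSeries) = 1 := by
  have h := congrArg (d⁄dX ℝ) treeSeries_eq
  simp only [map_add, Derivation.leibniz, derivative_X, smul_eq_mul] at h
  linear_combination h

/-- With `P` the proper-rank series, `P(1 - 2T) = R T` and `T'(1 - 2T) = 1` give `P = R T T'`; then
`2 T T' = T' - 1`. -/
theorem genFun_totalRank :
    2 * genFun (fun t => (t.totalRank : ℝ)) =
      (genFun fun t => (t.rootRank : ℝ)) * (1 + d⁄dX ℝ treeSeries) := by
  have h : genFun (fun t => (t.totalRank : ℝ)) =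
      (genFun fun t => (t.rootRank : ℝ)) + genFun fun t => (t.properRank : ℝ) := by
    rw [← genFun_add]
    simp [totalRank_eq]
  rw [h]
  linear_combination (2 * d⁄dX ℝ treeSeries) * genFun_properRank +
    (-2 * (genFun fun t => (t.properRank : ℝ)) -
      (genFun fun t => (t.rootRank : ℝ))) * derivative_treeSeries

/-- The analogue for the statistic 1 per vertex; it makes the fringe size probabilities sum to one.
-/
theorem treeSeries_mul_derivative :
    treeSeries * (1 + d⁄dX ℝ treeSeries) = 2 * (X * d⁄dX ℝ treeSeries) := by
  linear_combination (2 * d⁄dX ℝ treeSeries) * treeSeries_eq - treeSeries * derivative_treeSeries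

theorem derivative_treeSeries_mul :
    d⁄dX ℝ treeSeries * (1 - 4 * X) = 1 - 2 * treeSeries := by
  linear_combination (1 - 2 * treeSeries) * derivative_treeSeries +
    (4 * d⁄dX ℝ treeSeries) * treeSeries_eq

end PlaneTree

/-! ### Scheffé's lemma -/

open Filter

/-- Scheffé's lemma for probability distributions on `ℕ`, tested against a bounded function. -/
theorem tendsto_tsum_mul_of_hasSum_one {p : ℕ → ℕ → ℝ} {q f : ℕ → ℝ} {M : ℝ}
    (hp0 : ∀ n j, 0 ≤ p n j) (hp : ∀ᶠ n in atTop, HasSum (p n) 1)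
    (hq0 : ∀ j, 0 ≤ q j) (hq : HasSum q 1)
    (hlim : ∀ j, Tendsto (fun n => p n j) atTop (𝓝 (q j))) (hf : ∀ j, |f j| ≤ M) :
    Tendsto (fun n => ∑' j, f j * p n j) atTop (𝓝 (∑' j, f j * q j)) := by
  have hmin : Tendsto (fun n => ∑' j, min (p n j) (q j)) atTop (𝓝 1) := by
    rw [← hq.tsum_eq]
    refine tendsto_tsum_of_dominated_convergence hq.summable (fun j => ?_)
      (Eventually.of_forall fun n j => ?_)
    · simpa using (hlim j).min (tendsto_const_nhds (x := q j))
    · rw [Real.norm_of_nonneg (le_min (hp0 n j) (hq0 j))]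
      exact min_le_right _ _
  have hsummable : ∀ r : ℕ → ℝ, (∀ j, 0 ≤ r j) → Summable r → Summable fun j => f j * r j := by
    intro r hr0 hr
    refine Summable.of_norm_bounded (hr.mul_left M) fun j => ?_
    rw [norm_mul, Real.norm_of_nonneg (hr0 j)]
    exact mul_le_mul_of_nonneg_right (hf j) (hr0 j)
  -- Since `|p - q| = p + q - 2 min(p, q)`, this is `M` times the `ℓ¹` distance.
  have hbound : Tendsto (fun n => M * (1 + 1 - 2 * ∑' j, min (p n j) (q j))) atTop (𝓝 0) := by
    have := ((hmin.const_mul 2).const_sub (1 + 1)).const_mul M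
    norm_num at this ⊢
    exact this
  rw [tendsto_iff_norm_sub_tendsto_zero]
  refine squeeze_zero' (Eventually.of_forall fun n => norm_nonneg _) ?_ hbound
  filter_upwards [hp] with n hn
  have hms : Summable fun j => min (p n j) (q j) :=
    Summable.of_nonneg_of_le (fun j => le_min (hp0 n j) (hq0 j)) (fun j => min_le_right _ _)
      hq.summable
  have hs : HasSum (fun j => M * (p n j + q j - 2 * min (p n j) (q j)))
      (M * (1 + 1 - 2 * ∑' j, min (p n j) (q j))) :=
    ((hn.add hq).sub (hms.hasSum.mul_left 2)).mul_left M
  rw [← (hsummable _ (hp0 n) hn.summable).tsum_sub (hsummable _ hq0 hq.summable)]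
  refine tsum_of_norm_bounded hs fun j => ?_
  rw [← mul_sub, norm_mul]
  have habs : ‖p n j - q j‖ = p n j + q j - 2 * min (p n j) (q j) := by
    rw [Real.norm_eq_abs]
    rcases le_total (p n j) (q j) with h | h
    · rw [min_eq_left h, abs_of_nonpos (by linarith)]; ring
    · rw [min_eq_right h, abs_of_nonneg (by linarith)]; ring
  rw [habs]
  refine mul_le_mul_of_nonneg_right (hf j) ?_
  rw [← habs]
  exact norm_nonneg _

/-! ### Counting trees and marked trees -/

namespace PlaneTree

open PowerSeries

/-- The number of plane trees of size `n`. -/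
noncomputable def treeCount (n : ℕ) : ℝ := (ofSize n).card

theorem coeff_treeSeries (n : ℕ) : coeff n treeSeries = treeCount n := by
  simp [treeSeries, coeff_genFun, treeCount]

theorem treeCount_nonneg (n : ℕ) : 0 ≤ treeCount n := Nat.cast_nonneg _

theorem treeCount_zero : treeCount 0 = 0 := by
  have : ofSize 0 = ∅ := Finset.eq_empty_of_forall_notMem fun t ht =>
    t.size_pos.ne' (mem_ofSize.1 ht)
  simp [treeCount, this]

/-- The number of plane trees of size `n + 1` with a marked vertex. -/
noncomputable def markedCount (n : ℕ) : ℝ := coeff n (d⁄dX ℝ treeSeries)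

theorem markedCount_eq (n : ℕ) : markedCount n = treeCount (n + 1) * (n + 1) := by
  rw [markedCount, coeff_derivative, coeff_treeSeries]

theorem markedCount_zero : markedCount 0 = 1 := by
  have h := congrArg constantCoeff derivative_treeSeries_mul
  have h0 : constantCoeff treeSeries = 0 := by
    rw [← coeff_zero_eq_constantCoeff_apply, coeff_treeSeries, treeCount_zero]
  rw [markedCount, coeff_zero_eq_constantCoeff_apply]
  simpa [h0] using h

theorem treeCount_succ (n : ℕ) :
    treeCount (n + 1) = 2 * markedCount n - markedCount (n + 1) / 2 := by
  have h := congrArg (coeff (n + 1)) derivative_treeSeries_mul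
  have e : d⁄dX ℝ treeSeries * (1 - 4 * X) = d⁄dX ℝ treeSeries - C 4 * (d⁄dX ℝ treeSeries * X) := by
    rw [map_ofNat]; ring
  have e' : (1 - 2 * treeSeries) = 1 - C 2 * treeSeries := by rw [map_ofNat]
  rw [e, e', map_sub, map_sub, coeff_C_mul, coeff_C_mul, coeff_succ_mul_X, coeff_treeSeries,
    coeff_one, if_neg n.succ_ne_zero, ← markedCount, ← markedCount] at h
  linarith

/-- The recurrence of the central binomial coefficients; it yields the ratio limit 1/4. -/
theorem markedCount_succ (n : ℕ) :
    (n + 1) * markedCount (n + 1) = (4 * n + 2) * markedCount n := by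
  have h1 := treeCount_succ n
  have h2 := markedCount_eq n
  rw [h1] at h2
  linarith

theorem markedCount_pos (n : ℕ) : 0 < markedCount n := by
  induction n with
  | zero => simp [markedCount_zero]
  | succ n ih =>
    have h := markedCount_succ n
    have : 0 < ((n : ℝ) + 1) * markedCount (n + 1) := by rw [h]; positivity
    exact pos_of_mul_pos_right this (by positivity)

theorem treeCount_succ_pos (n : ℕ) : 0 < treeCount (n + 1) := by
  have h := markedCount_pos n
  rw [markedCount_eq] at h
  exact pos_of_mul_pos_left h (by positivity)

theorem treeCount_succ_le {n : ℕ} (hn : n ≠ 0) : treeCount (n + 1) ≤ 4 * treeCount n := by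
  obtain ⟨n, rfl⟩ := Nat.exists_eq_succ_of_ne_zero hn
  have h1 := treeCount_succ n
  have h2 := markedCount_succ n
  have h3 := markedCount_eq n
  have h4 := markedCount_eq (n + 1)
  have h5 := treeCount_succ_pos n
  have h6 := treeCount_succ_pos (n + 1)
  push_cast at *
  nlinarith

/-- The sum telescopes by `treeCount_succ`. It serves to bound the partial sums. -/
theorem sum_treeCount (n : ℕ) :
    ∑ j ∈ Finset.range (n + 1), treeCount j / 4 ^ j = 1 / 2 - markedCount n / (2 * 4 ^ n) := by
  induction n with
  | zero => simp [treeCount_zero, markedCount_zero]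
  | succ n ih =>
    rw [Finset.sum_range_succ, ih, treeCount_succ, pow_succ]
    field_simp
    ring

theorem tendsto_markedCount_div_succ :
    Tendsto (fun n => markedCount n / markedCount (n + 1)) atTop (𝓝 (1 / 4)) := by
  have e : ∀ n : ℕ, markedCount n / markedCount (n + 1) = 1 / 4 + 1 / 8 / ((n : ℝ) + 1 / 2) := by
    intro n
    have h := markedCount_succ n
    have := markedCount_pos n
    have := markedCount_pos (n + 1)
    field_simp
    linarith
  simp only [e]
  have : Tendsto (fun n : ℕ => 1 / 8 / ((n : ℝ) + 1 / 2)) atTop (𝓝 0) :=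
    tendsto_const_nhds.div_atTop
      (tendsto_atTop_add_const_right _ _ tendsto_natCast_atTop_atTop)
  simpa only [add_zero] using this.const_add (1 / 4)

theorem tendsto_markedCount_div (i : ℕ) :
    Tendsto (fun n => markedCount n / markedCount (n + i)) atTop (𝓝 ((1 / 4) ^ i)) := by
  induction i with
  | zero =>
    simp [div_self (markedCount_pos _).ne']
  | succ i ih =>
    have h := ih.mul (tendsto_markedCount_div_succ.comp (tendsto_add_atTop_nat i))
    rw [← pow_succ] at h
    refine h.congr fun n => ?_
    have := markedCount_pos (n + i)
    simp only [Function.comp, ← add_assoc]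
    field_simp

/-! ### The fringe subtree at a random vertex -/

/-- The number of ways in which a tree can be the fringe subtree of a tree with `m` more
vertices. -/
noncomputable def contextCount (m : ℕ) : ℝ := (markedCount m + if m = 0 then 1 else 0) / 2

theorem contextCount_nonneg (m : ℕ) : 0 ≤ contextCount m := by
  have := markedCount_pos m
  unfold contextCount
  split_ifs <;> positivity

theorem coeff_one_add_derivative (m : ℕ) :
    coeff m (1 + d⁄dX ℝ treeSeries) = 2 * contextCount m := by
  rw [map_add, coeff_one, ← markedCount, contextCount]
  ring

/-- The sum of the ranks of the roots of all trees of size `n`. -/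
noncomputable def rootRankSum (n : ℕ) : ℝ := ∑ t ∈ ofSize n, (t.rootRank : ℝ)

theorem rootRankSum_nonneg (n : ℕ) : 0 ≤ rootRankSum n :=
  Finset.sum_nonneg fun _ _ => Nat.cast_nonneg _

theorem sum_totalRank (n : ℕ) :
    ∑ t ∈ ofSize n, (t.totalRank : ℝ) =
      ∑ j ∈ Finset.range (n + 1), rootRankSum j * contextCount (n - j) := by
  have h := congrArg (coeff n) genFun_totalRank
  have e : 2 * genFun (fun t => (t.totalRank : ℝ)) =
      C 2 * genFun (fun t => (t.totalRank : ℝ)) := by rw [map_ofNat]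
  rw [e, coeff_C_mul, coeff_mul, coeff_genFun, Finset.Nat.sum_antidiagonal_eq_sum_range_succ_mk] at h
  simp only [coeff_one_add_derivative, coeff_genFun] at h
  rw [← mul_right_inj' (two_ne_zero (α := ℝ)), h, Finset.mul_sum]
  exact Finset.sum_congr rfl fun j _ => by rw [rootRankSum]; ring

theorem sum_treeCount_mul_contextCount (n : ℕ) :
    ∑ j ∈ Finset.range (n + 2), treeCount j * contextCount (n + 1 - j) = markedCount n := by
  have h := congrArg (coeff (n + 1)) treeSeries_mul_derivative
  have e : 2 * (X * d⁄dX ℝ treeSeries) = C 2 * (X * d⁄dX ℝ treeSeries) := by rw [map_ofNat]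
  rw [e, coeff_C_mul, coeff_succ_X_mul, coeff_mul,
    Finset.Nat.sum_antidiagonal_eq_sum_range_succ_mk, ← markedCount] at h
  simp only [coeff_one_add_derivative, coeff_treeSeries] at h
  rw [← mul_right_inj' (two_ne_zero (α := ℝ)), ← h, Finset.mul_sum]
  exact Finset.sum_congr rfl fun j _ => by ring

/-- The length of the path that starts at the root and always moves to the first child. -/
def firstPathLength : PlaneTree → ℕ
  | node [] => 0
  | node (a :: _) => firstPathLength a + 1

theorem firstPathLength_cons (a b : PlaneTree) :
    (cons a b).firstPathLength = a.firstPathLength + 1 := by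
  obtain ⟨l⟩ := b
  rw [cons, firstPathLength]

theorem rootRank_le_firstPathLength (t : PlaneTree) : t.rootRank ≤ t.firstPathLength := by
  induction t using cons_induction with
  | leaf => simp [rootRank_leaf]
  | cons a b ha _ =>
    rw [firstPathLength_cons]
    have := rootRank_cons_le a b
    omega

/-- The first-child path ends at a leaf, so it bounds the rank, and its total over trees of size `n
≥ 1` is `c_{n+1} - c_n`. This supplies the bounded test function for Scheffé's lemma. -/
theorem rootRankSum_le (n : ℕ) : rootRankSum n ≤ 4 * treeCount n := by
  rcases eq_or_ne n 0 with rfl | hn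
  · have : ofSize 0 = ∅ := Finset.eq_empty_of_forall_notMem fun t ht =>
      t.size_pos.ne' (mem_ofSize.1 ht)
    simp [rootRankSum, treeCount, this]
  have h := congrArg (coeff (n + 1)) (genFun_firstPath (fun t => (t.firstPathLength : ℝ))
    (by simp [firstPathLength]) (by simp [firstPathLength_cons]))
  rw [coeff_succ_X_mul, map_sub, map_sub, coeff_succ_X_mul, coeff_X, coeff_treeSeries,
    coeff_treeSeries, if_neg (by omega), coeff_genFun] at h
  calc rootRankSum n ≤ ∑ t ∈ ofSize n, (t.firstPathLength : ℝ) :=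
        Finset.sum_le_sum fun t _ => Nat.cast_le.2 t.rootRank_le_firstPathLength
    _ ≤ treeCount (n + 1) := by have := treeCount_nonneg n; linarith
    _ ≤ 4 * treeCount n := treeCount_succ_le hn

/-- The distribution of the size of the fringe subtree at a random vertex of a random tree of
size `n`. -/
noncomputable def fringeSizeProb (n j : ℕ) : ℝ :=
  if j ≤ n then treeCount j * contextCount (n - j) / markedCount (n - 1) else 0

theorem fringeSizeProb_nonneg (n j : ℕ) : 0 ≤ fringeSizeProb n j := by
  unfold fringeSizeProb
  split_ifs
  · exact div_nonneg (mul_nonneg (treeCount_nonneg _) (contextCount_nonneg _))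
      (markedCount_pos _).le
  · exact le_rfl

theorem hasSum_fringeSizeProb {n : ℕ} (hn : n ≠ 0) : HasSum (fringeSizeProb n) 1 := by
  obtain ⟨n, rfl⟩ := Nat.exists_eq_succ_of_ne_zero hn
  have h : ∑ j ∈ Finset.range (n + 2), fringeSizeProb (n + 1) j = 1 := by
    rw [← div_self (markedCount_pos n).ne', ← sum_treeCount_mul_contextCount n, Finset.sum_div]
    refine Finset.sum_congr rfl fun j hj => ?_
    rw [fringeSizeProb, if_pos (by simp at hj; omega), sum_treeCount_mul_contextCount]
    rfl
  rw [← h]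
  refine hasSum_sum_of_ne_finset_zero fun j hj => ?_
  rw [fringeSizeProb, if_neg (by simp at hj; omega)]

theorem tendsto_fringeSizeProb (j : ℕ) :
    Tendsto (fun n => fringeSizeProb n j) atTop (𝓝 (2 * (treeCount j / 4 ^ j))) := by
  rcases j with _ | i
  · simp [fringeSizeProb, treeCount_zero]
  -- Replacing `n` by `n + i + 1` turns the indices `n - j` and `n - 1` into `n` and `n + i`.
  · rw [← tendsto_add_atTop_iff_nat (i + 1)]
    have h := (tendsto_markedCount_div i).const_mul (treeCount (i + 1) / 2)
    have e : 2 * (treeCount (i + 1) / 4 ^ (i + 1)) = treeCount (i + 1) / 2 * (1 / 4) ^ i := by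
      rw [one_div, inv_pow, pow_succ]
      field_simp
      norm_num [mul_comm]
    rw [e]
    refine h.congr' ?_
    filter_upwards [eventually_ne_atTop 0] with n hn
    rw [fringeSizeProb, if_pos (by omega), contextCount, Nat.add_sub_cancel, if_neg hn,
      ← add_assoc, Nat.add_sub_cancel]
    ring

theorem expectedRank_eq {n : ℕ} (hn : n ≠ 0) :
    expectedRank n = ∑' j, rootRankSum j / treeCount j * fringeSizeProb n j := by
  obtain ⟨n, rfl⟩ := Nat.exists_eq_add_one_of_ne_zero hn
  rw [tsum_eq_sum (s := Finset.range (n + 2))]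
  · have h1 : expectedRank (n + 1) =
        (∑ t ∈ ofSize (n + 1), (t.totalRank : ℝ)) / markedCount n := by
      rw [expectedRank, Finset.expect_eq_sum_div_card, markedCount_eq, treeCount, mul_comm,
        ← div_div]
      congr 1
      rw [Finset.sum_div]
      refine Finset.sum_congr rfl fun t ht => ?_
      rw [Finset.expect_eq_sum_div_card, ← size, mem_ofSize.1 ht, totalRank]
      push_cast
      rfl
    rw [h1, sum_totalRank, Finset.sum_div]
    refine Finset.sum_congr rfl fun j hj => ?_
    rw [fringeSizeProb, if_pos (by simp at hj; omega)]
    -- At `j = 0` the division by `treeCount 0 = 0` is harmless, because `rootRankSum 0 = 0`.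
    rcases j with _ | j
    · have : rootRankSum 0 = 0 :=
        le_antisymm (by simpa [treeCount_zero] using rootRankSum_le 0) (rootRankSum_nonneg 0)
      simp [this]
    · have := treeCount_succ_pos j
      have := markedCount_pos n
      rw [Nat.add_sub_cancel]
      field_simp
  · intro j hj
    rw [fringeSizeProb, if_neg (by simp at hj; omega), mul_zero]

theorem abs_rootRankSum_div_le (j : ℕ) : |rootRankSum j / treeCount j| ≤ 4 := by
  rw [abs_of_nonneg (div_nonneg (rootRankSum_nonneg j) (treeCount_nonneg j))]
  exact div_le_of_le_mul₀ (treeCount_nonneg j) (by norm_num) (rootRankSum_le j)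

theorem rootRankSum_div_mul (j : ℕ) :
    rootRankSum j / treeCount j * (2 * (treeCount j / 4 ^ j)) = 2 * (rootRankSum j / 4 ^ j) := by
  rcases j with _ | j
  · have : rootRankSum 0 = 0 :=
      le_antisymm (by simpa [treeCount_zero] using rootRankSum_le 0) (rootRankSum_nonneg 0)
    simp [this]
  · have := treeCount_succ_pos j
    field_simp

theorem tendsto_expectedRank (h : HasSum (fun j => treeCount j / 4 ^ j) (1 / 2)) :
    Tendsto expectedRank atTop (𝓝 (2 * ∑' j, rootRankSum j / 4 ^ j)) := by
  have key := tendsto_tsum_mul_of_hasSum_one (f := fun j => rootRankSum j / treeCount j)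
    fringeSizeProb_nonneg
    ((eventually_ne_atTop 0).mono fun n hn => hasSum_fringeSizeProb hn)
    (fun j => mul_nonneg two_pos.le (div_nonneg (treeCount_nonneg j) (by positivity)))
    (by simpa using h.mul_left 2) tendsto_fringeSizeProb abs_rootRankSum_div_le
  simp only [rootRankSum_div_mul, tsum_mul_left] at key
  exact key.congr' ((eventually_ne_atTop 0).mono fun n hn => (expectedRank_eq hn).symm)

end PlaneTree

/-! ### Boltzmann weights and the law of the root rank -/

open scoped ENNReal

namespace PlaneTree

/-- The critical Boltzmann weight `4 ^ (-|t|)` of a plane tree. -/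
noncomputable def weight (t : PlaneTree) : ℝ≥0∞ := (4 : ℝ≥0∞)⁻¹ ^ t.size

theorem weight_cons (a b : PlaneTree) : (cons a b).weight = a.weight * b.weight := by
  rw [weight, weight, weight, size_cons, pow_add]

theorem tsum_eq_leaf_add (φ : PlaneTree → ℝ≥0∞) :
    ∑' t, φ t = φ (node []) + ∑' a, ∑' b, φ (cons a b) := by
  rw [← sumEquiv.tsum_eq φ, ENNReal.summable.tsum_sum ENNReal.summable, ← ENNReal.tsum_prod,
    tsum_fintype, Fintype.sum_unique]
  rfl

theorem tsum_mul_weight (φ : PlaneTree → ℝ) (hφ : ∀ t, 0 ≤ φ t) :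
    ∑' t, ENNReal.ofReal (φ t) * t.weight =
      ∑' n, ENNReal.ofReal ((∑ t ∈ ofSize n, φ t) / 4 ^ n) := by
  rw [← ENNReal.tsum_fiberwise _ size]
  refine tsum_congr fun n => ?_
  have e : (size ⁻¹' {n} : Set PlaneTree) = ↑(ofSize n) := by
    ext t
    simp [mem_ofSize]
  rw [e, Finset.tsum_subtype' (ofSize n) fun t => ENNReal.ofReal (φ t) * t.weight,
    Finset.sum_div, ENNReal.ofReal_sum_of_nonneg fun t _ => div_nonneg (hφ t) (by positivity)]
  refine Finset.sum_congr rfl fun t ht => ?_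
  rw [weight, mem_ofSize.1 ht, div_eq_mul_inv, ENNReal.ofReal_mul (hφ t), ← inv_pow,
    ENNReal.ofReal_pow (by norm_num), ENNReal.ofReal_inv_of_pos (by norm_num)]
  norm_num

theorem summable_treeCount_div : Summable fun j => treeCount j / 4 ^ j :=
  summable_of_sum_range_le (c := 1 / 2)
    (fun j => div_nonneg (treeCount_nonneg j) (by positivity)) fun n => by
      rcases n with _ | n
      · simp
      · rw [sum_treeCount]
        have := markedCount_pos n
        have : 0 < markedCount n / (2 * 4 ^ n) := by positivity
        linarith

theorem tsum_weight_eq_ofReal :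
    ∑' t, weight t = ENNReal.ofReal (∑' j, treeCount j / 4 ^ j) := by
  have h := tsum_mul_weight (fun _ => 1) fun _ => zero_le_one
  rw [ENNReal.ofReal_tsum_of_nonneg
    (fun j => div_nonneg (treeCount_nonneg j) (by positivity)) summable_treeCount_div]
  simpa [treeCount] using h

theorem tsum_weight : ∑' t, weight t = 2⁻¹ := by
  have hne : ∑' t, weight t ≠ ∞ := by
    rw [tsum_weight_eq_ofReal]
    exact ENNReal.ofReal_ne_top
  have h := tsum_eq_leaf_add weight
  simp only [weight_cons, ENNReal.tsum_mul_left, ENNReal.tsum_mul_right] at h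
  rw [weight, size_leaf, pow_one] at h
  lift ∑' t, weight t to NNReal using hne with x
  have h' : (x : ℝ) = 4⁻¹ + x * x := by
    have := congrArg ENNReal.toReal h
    rwa [ENNReal.toReal_add (by simp) (by finiteness), ENNReal.toReal_mul, ENNReal.toReal_inv,
      ENNReal.coe_toReal] at this
  -- At the critical weight the quadratic is `(x - 1/2)² = 0`, so no choice of root arises.
  have hx : (x : ℝ) = 2⁻¹ := by nlinarith [sq_nonneg ((x : ℝ) - 2⁻¹)]
  have : x = 2⁻¹ := by
    ext
    simpa using hx
  rw [this]
  simp

theorem hasSum_treeCount_div : HasSum (fun j => treeCount j / 4 ^ j) (1 / 2) := by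
  have h := congrArg ENNReal.toReal (tsum_weight_eq_ofReal.symm.trans tsum_weight)
  rw [ENNReal.toReal_ofReal (tsum_nonneg fun j => div_nonneg (treeCount_nonneg j) (by positivity))]
    at h
  have := summable_treeCount_div.hasSum
  rw [h] at this
  simpa using this

open Classical in
/-- The total weight of the trees whose root has rank at least `k`. -/
noncomputable def rankWeight (k : ℕ) : ℝ≥0∞ :=
  ∑' t : PlaneTree, (if k ≤ t.rootRank then 1 else 0) * t.weight

open Classical in
/-- The total weight of the trees all of whose root's children have rank at least `k`. -/
noncomputable def childrenRankWeight (k : ℕ) : ℝ≥0∞ :=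
  ∑' t : PlaneTree, (if ChildrenRankGE k t then 1 else 0) * t.weight

theorem tsum_ite_and_mul_weight (P Q : PlaneTree → Prop) [DecidablePred P] [DecidablePred Q] :
    ∑' a, ∑' b, (if P a ∧ Q b then 1 else 0) * (a.weight * b.weight) =
      (∑' t : PlaneTree, (if P t then 1 else 0) * t.weight) *
        ∑' t : PlaneTree, (if Q t then 1 else 0) * t.weight := by
  rw [← ENNReal.tsum_mul_right]
  refine tsum_congr fun a => ?_
  rw [← ENNReal.tsum_mul_left]
  refine tsum_congr fun b => ?_
  by_cases h1 : P a <;> by_cases h2 : Q b <;> simp [h1, h2]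

/-- The single vertex, of weight 1/4, qualifies vacuously; otherwise `childrenRankGE_cons` factors
the sum. -/
theorem childrenRankWeight_eq (k : ℕ) :
    childrenRankWeight k = 4⁻¹ + rankWeight k * childrenRankWeight k := by
  classical
  conv_lhs => rw [childrenRankWeight, tsum_eq_leaf_add]
  simp only [childrenRankGE_cons, weight_cons]
  rw [tsum_ite_and_mul_weight, if_pos (childrenRankGE_leaf k), weight, size_leaf]
  simp [rankWeight, childrenRankWeight]

theorem rankWeight_succ (k : ℕ) :
    rankWeight (k + 1) = rankWeight k * childrenRankWeight k := by
  classical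
  conv_lhs => rw [rankWeight, tsum_eq_leaf_add]
  simp only [succ_le_rootRank_cons, weight_cons]
  rw [tsum_ite_and_mul_weight, if_neg (by simp [rootRank_leaf])]
  simp [rankWeight, childrenRankWeight]

theorem childrenRankWeight_ne_top (k : ℕ) : childrenRankWeight k ≠ ∞ := by
  refine ne_top_of_le_ne_top (b := 2⁻¹) (by simp) ?_
  rw [← tsum_weight]
  refine ENNReal.tsum_le_tsum fun t => ?_
  split_ifs <;> simp

/-- The reciprocals obey the affine recursion `1/W_{k+1} = 4/W_k - 4`, with fixed point 4/3 and
`1/W_0 = 2`. -/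
theorem rankWeight_eq (k : ℕ) : rankWeight k = ENNReal.ofReal (3 / (2 * 4 ^ k + 4)) := by
  induction k with
  | zero =>
    rw [rankWeight]
    simp only [Nat.zero_le, if_true, one_mul]
    rw [tsum_weight, ← ENNReal.ofReal_ofNat, ← ENNReal.ofReal_inv_of_pos (by norm_num)]
    norm_num
  | succ k ih =>
    have h := childrenRankWeight_eq k
    rw [rankWeight_succ]
    have hne := childrenRankWeight_ne_top k
    have h' := congrArg ENNReal.toReal h
    have hp : (0 : ℝ) < 4 ^ k := by positivity
    rw [ENNReal.toReal_add (by simp) (by rw [ih]; finiteness), ENNReal.toReal_mul, ih,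
      ENNReal.toReal_ofReal (by positivity), ENNReal.toReal_inv, ENNReal.toReal_ofNat] at h'
    have hq : (childrenRankWeight k).toReal = (4 ^ k + 2) / (4 * 4 ^ k + 2) := by
      field_simp at h' ⊢
      linarith
    rw [ih, ← ENNReal.ofReal_toReal hne, hq, ← ENNReal.ofReal_mul (by positivity)]
    congr 1
    rw [pow_succ]
    field_simp
    ring

theorem tsum_ite_succ_le (r : ℕ) :
    ∑' k : ℕ, (if k + 1 ≤ r then (1 : ℝ≥0∞) else 0) = r := by
  rw [tsum_eq_sum (s := Finset.range r) fun k hk => if_neg (by simpa using hk)]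
  rw [Finset.sum_congr rfl fun k hk => if_pos (by simpa using hk)]
  simp

/-- Layer-cake formula: a rank `r` is the number of `k` with `k + 1 ≤ r`. -/
theorem tsum_rootRank_mul_weight :
    ∑' t : PlaneTree, (t.rootRank : ℝ≥0∞) * t.weight = ∑' k, rankWeight (k + 1) := by
  simp only [rankWeight]
  rw [ENNReal.tsum_comm]
  refine tsum_congr fun t => ?_
  rw [ENNReal.tsum_mul_right, ← tsum_ite_succ_le t.rootRank]

theorem summable_rank_tail : Summable fun k : ℕ => (3 : ℝ) / (4 ^ (k + 1) + 2) := by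
  refine Summable.of_nonneg_of_le (fun k => by positivity) (fun k => ?_)
    ((summable_geometric_of_lt_one (r := (1 / 4 : ℝ)) (by norm_num) (by norm_num)).mul_left 3)
  rw [one_div, inv_pow, ← div_eq_mul_inv]
  gcongr
  rw [pow_succ]
  have : (0 : ℝ) < 4 ^ k := by positivity
  linarith

theorem two_mul_tsum_rootRankSum :
    2 * ∑' j, rootRankSum j / 4 ^ j = ∑' k : ℕ, (3 : ℝ) / (4 ^ (k + 1) + 2) := by
  have h := tsum_mul_weight (fun t => (t.rootRank : ℝ)) fun _ => Nat.cast_nonneg _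
  simp only [ENNReal.ofReal_natCast] at h
  change _ = ∑' n, ENNReal.ofReal (rootRankSum n / 4 ^ n) at h
  have hs : Summable fun j => rootRankSum j / 4 ^ j := by
    refine Summable.of_nonneg_of_le
      (fun j => div_nonneg (rootRankSum_nonneg j) (by positivity)) (fun j => ?_)
      (summable_treeCount_div.mul_left 4)
    rw [← mul_div_assoc]
    gcongr
    exact rootRankSum_le j
  have e : ∀ k : ℕ, (3 : ℝ) / (2 * 4 ^ (k + 1) + 4) = 3 / (4 ^ (k + 1) + 2) / 2 := by
    intro k
    rw [div_div]
    ring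
  simp only [tsum_rootRank_mul_weight, rankWeight_eq, e] at h
  rw [← ENNReal.ofReal_tsum_of_nonneg (fun k => by positivity) (summable_rank_tail.div_const 2),
    ← ENNReal.ofReal_tsum_of_nonneg
      (fun j => div_nonneg (rootRankSum_nonneg j) (by positivity)) hs,
    ENNReal.ofReal_eq_ofReal_iff (tsum_nonneg fun k => by positivity)
      (tsum_nonneg fun j => div_nonneg (rootRankSum_nonneg j) (by positivity)),
    tsum_div_const] at h
  rw [← h]
  ring

/-! ### Numerical value -/

theorem abs_tsum_sub_lt :
    |(∑' k : ℕ, (3 : ℝ) / (4 ^ (k + 1) + 2)) - 0.727649| < 5 / 10 ^ 7 := by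
  have hs := summable_rank_tail
  rw [← hs.sum_add_tsum_nat_add 12]
  have h0 : 0 ≤ ∑' k : ℕ, (3 : ℝ) / (4 ^ (k + 12 + 1) + 2) := tsum_nonneg fun k => by positivity
  -- Dropping the `+ 2` leaves a geometric tail of about `6e-8`; the first twelve terms are summed
  -- exactly.
  have h1 : ∑' k : ℕ, (3 : ℝ) / (4 ^ (k + 12 + 1) + 2) ≤ (1 / 4) ^ 12 := by
    have hg : HasSum (fun k : ℕ => 3 / 4 ^ 13 * (1 / 4 : ℝ) ^ k) (3 / 4 ^ 13 * (1 - 1 / 4)⁻¹) :=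
      (hasSum_geometric_of_lt_one (by norm_num) (by norm_num)).mul_left _
    have he : (3 / 4 ^ 13 * (1 - 1 / 4)⁻¹ : ℝ) = (1 / 4) ^ 12 := by norm_num
    rw [← he]
    refine hasSum_le (fun k => ?_) ((summable_nat_add_iff 12).2 hs).hasSum hg
    have e : (3 : ℝ) / 4 ^ 13 * (1 / 4) ^ k = 3 / 4 ^ (k + 12 + 1) := by
      rw [one_div, inv_pow, add_assoc, pow_add]
      field_simp
    rw [e]
    gcongr
    linarith
  norm_num [Finset.sum_range_succ] at h1 ⊢
  rw [abs_lt]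
  constructor <;> linarith

end PlaneTree

theorem theorem6 :
    Summable (fun k : ℕ => (3 : ℝ) / (4 ^ (k + 1) + 2)) ∧
    Filter.Tendsto PlaneTree.expectedRank Filter.atTop
      (𝓝 (∑' k : ℕ, (3 : ℝ) / (4 ^ (k + 1) + 2))) ∧
    |(∑' k : ℕ, (3 : ℝ) / (4 ^ (k + 1) + 2)) - 0.727649| < 5 / 10 ^ 7 := by
  refine ⟨PlaneTree.summable_rank_tail, ?_, PlaneTree.abs_tsum_sub_lt⟩
  rw [← PlaneTree.two_mul_tsum_rootRankSum]
  exact PlaneTree.tendsto_expectedRank PlaneTree.hasSum_treeCount_div
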